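/- Theorem (vertex counts of slices of cyclic polytopes). Let $d\ge 3$ and $n\ge d+1$ be integers, let $t_1<t_2<\dots<t_n$ be real numbers, and let $$C_d(n)=\operatorname{conv}\{\gamma(t_1),\dots,\gamma(t_n)\}\subset\mathbb{R}^d,\qquad \gamma(t)=(t,t^2,\dots,t^d),$$ be the corresponding cyclic polytope. For a hyperplane $H\subset\mathbb{R}^d$ with $H\cap C_d(n)\neq\emptyset$, let $|V(H\cap C_d(n))|$ be the number of vertices of the polytope $H\cap C_d(n)$, and let $$VSS(C_d(n))=\{\,|V(H\cap C_d(n))| : H \text{ a hyperplane},\ H\cap C_d(n)\neq\emptyset\,\}.$$ Then $$VSS(C_d(n))=\begin{cases}\{1,2,\dots,2(n-2)\} & \text{if } d=3,\\[2pt] \{\,a b+i : a,b\in\{0,1,\dots,n-1\},\ i\in\{0,1,\dots,d\},\ a+b=n-i\,\} & \text{if } d>3.\end{cases}$$ -/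

import Mathlib

/-- The moment curve `t ↦ (t, t ^ 2, …, t ^ d)` in `ℝ ^ d`. -/
noncomputable def momentCurve (d : ℕ) (t : ℝ) : EuclideanSpace ℝ (Fin d) :=
  WithLp.toLp 2 (fun j : Fin d => t ^ ((j : ℕ) + 1))

/-- The cyclic polytope with `n` vertices on the moment curve in `ℝ ^ d`, at the parameters
`t 0, …, t (n - 1)` (taken to be strictly increasing wherever this is used). -/
noncomputable def cyclicPolytope (d : ℕ) {n : ℕ} (t : Fin n → ℝ) :
    Set (EuclideanSpace ℝ (Fin d)) :=
  convexHull ℝ (Set.range fun k : Fin n => momentCurve d (t k))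

/-- A hyperplane of `ℝ ^ d`: the solution set of `⟨u, x⟩ = c` for some normal vector `u ≠ 0`. -/
def IsHyperplane {d : ℕ} (H : Set (EuclideanSpace ℝ (Fin d))) : Prop :=
  ∃ (u : EuclideanSpace ℝ (Fin d)) (c : ℝ), u ≠ 0 ∧ H = {x | inner ℝ u x = c}

/-- The number of vertices (extreme points) of the slice `H ∩ P`. -/
noncomputable def sliceVertexCount {d : ℕ} (P H : Set (EuclideanSpace ℝ (Fin d))) : ℕ :=
  (Set.extremePoints ℝ (H ∩ P)).ncard

/-- The set of all vertex counts of slices of `P`, where `H` runs over the hyperplanes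
that meet `P`. -/
noncomputable def vertexSliceSequence {d : ℕ} (P : Set (EuclideanSpace ℝ (Fin d))) : Set ℕ :=
  {m | ∃ H : Set (EuclideanSpace ℝ (Fin d)),
    IsHyperplane H ∧ (H ∩ P).Nonempty ∧ sliceVertexCount P H = m}

/-!
A hyperplane of `ℝ ^ d` restricts to the moment curve as a nonconstant polynomial `p` of degree at
most `d`, and every such polynomial arises (`inner_momentCurve`, `exists_polynomial_eval_eq`). The
vertices of the slice are the vertices `γ (t k)` with `p (t k) = 0` and the points where the
hyperplane crosses an edge of the polytope (`ncard_extremePoints_slice`). Hence the vertex count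
depends only on the signs of `p` at the parameters and on the edges of the polytope
(`mem_vertexSliceSequence_iff`).

Edges are recognised by a polynomial of degree at most `d` that is nonnegative at all parameters and
vanishes at exactly two of them. For the converse, a point of the slice written as a convex
combination with three positive weights is never extreme (`not_extreme_of_three_weights`), because
no three points of the moment curve are affinely dependent. This also shows that extreme points of
the slice come from single vertices and from pairs.

If `d > 3`, the polynomial `(X - t i) ^ 2 * (X - t j) ^ 2` makes every pair an edge, so a slice with
`a` vertices on one side, `b` on the other and `i` on the hyperplane has `a * b + i` vertices. There
are at most `d` zeros, and all sign distributions subject to this occur, apart from those with all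
vertices strictly on one side, which give empty slices (`exists_polynomial_signs`): an odd number of
consecutive simple zeros separates the negative from the positive values, and if the number of zeros
is even and positive, one is moved to the first parameter.

If `d = 3`, the edges are the pairs through the first or the last vertex and the consecutive pairs.
A further pair is no edge because of the Radon relation with the first vertex, the last vertex and
one in between (`exists_radon_relation`). Counting crossed edges gives the bound `2 * (n - 2)`
(`signCount_isCyclicEdge_le`), and cutting off a block of inner vertices gives the values
(`exists_polynomial_signCount`).
-/

/-! ### Extreme points of a hyperplane slice of a finite convex hull -/

section Slice

variable {E ι : Type*} [AddCommGroup E] [Module ℝ E]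

/-- The set `T` of indices labels a face of the convex hull of the points `v k`: some affine
functional is nonnegative on all points and vanishes exactly at those indexed by `T`. -/
def IsFaceIndex (v : ι → E) (T : Set ι) : Prop :=
  ∃ (g : E →ₗ[ℝ] ℝ) (e : ℝ), ∀ k, 0 ≤ g (v k) - e ∧ (g (v k) - e = 0 ↔ k ∈ T)

/-- No three of the points `v k` are affinely dependent. -/
def NoThreeDependent (v : ι → E) : Prop :=
  ∀ a b c : ι, a ≠ b → a ≠ c → b ≠ c → ∀ α β γ : ℝ, α + β + γ = 0 →
    α • v a + β • v b + γ • v c = 0 → α = 0 ∧ β = 0 ∧ γ = 0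

/-- The point where the line through `v i` and `v j` meets the hyperplane `φ = c`; it is meaningful
when `φ - c` takes distinct values at the two points. -/
noncomputable def crossing (v : ι → E) (φ : E →ₗ[ℝ] ℝ) (c : ℝ) (i j : ι) : E :=
  ((φ (v j) - c) / (φ (v j) - φ (v i))) • v i + ((c - φ (v i)) / (φ (v j) - φ (v i))) • v j

variable {v : ι → E} {φ : E →ₗ[ℝ] ℝ} {c : ℝ}

theorem value_sub_ne_zero {i j : ι} (h : (φ (v i) - c) * (φ (v j) - c) < 0) :
    φ (v j) - φ (v i) ≠ 0 := by
  intro h0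
  rw [sub_eq_zero.1 h0] at h
  exact absurd h (mul_self_nonneg _).not_gt

/-- The weights of a crossing point on a segment whose ends lie strictly on different sides. -/
theorem crossing_weights {i j : ι} (h : (φ (v i) - c) * (φ (v j) - c) < 0) :
    ∃ α β : ℝ, 0 < α ∧ 0 < β ∧ α + β = 1 ∧
      α * (φ (v i) - c) + β * (φ (v j) - c) = 0 ∧ crossing v φ c i j = α • v i + β • v j := by
  refine ⟨_, _, ?_, ?_, ?_, ?_, rfl⟩
  · rcases mul_neg_iff.1 h with ⟨h1, h2⟩ | ⟨h1, h2⟩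
    · exact div_pos_of_neg_of_neg (by linarith) (by linarith)
    · exact div_pos (by linarith) (by linarith)
  · rcases mul_neg_iff.1 h with ⟨h1, h2⟩ | ⟨h1, h2⟩
    · exact div_pos_of_neg_of_neg (by linarith) (by linarith)
    · exact div_pos (by linarith) (by linarith)
  all_goals
    have := value_sub_ne_zero h
    field_simp
    ring

theorem eq_crossing {i j : ι} (h : (φ (v i) - c) * (φ (v j) - c) < 0) {α β : ℝ}
    (h1 : α + β = 1) (h0 : α * (φ (v i) - c) + β * (φ (v j) - c) = 0) :
    α • v i + β • v j = crossing v φ c i j := by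
  have := value_sub_ne_zero h
  obtain rfl : β = 1 - α := by linarith
  unfold crossing
  congr 2
  · field_simp
    linarith
  · field_simp
    linarith

theorem crossing_mem_slice {i j : ι} (h : (φ (v i) - c) * (φ (v j) - c) < 0) :
    crossing v φ c i j ∈ {x | φ x = c} ∩ convexHull ℝ (Set.range v) := by
  obtain ⟨α, β, hα, hβ, h1, h0, hc⟩ := crossing_weights h
  rw [hc]
  refine ⟨?_, (convex_convexHull ℝ _) (subset_convexHull ℝ _ (Set.mem_range_self i))
    (subset_convexHull ℝ _ (Set.mem_range_self j)) hα.le hβ.le h1⟩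
  simp only [Set.mem_ofPred_eq, map_add, map_smul, smul_eq_mul]
  linear_combination h0 + c * h1

theorem crossing_mem_face {i j : ι} (h : (φ (v i) - c) * (φ (v j) - c) < 0)
    {g : E →ₗ[ℝ] ℝ} {e : ℝ} {T : Set ι}
    (hg : ∀ k, 0 ≤ g (v k) - e ∧ (g (v k) - e = 0 ↔ k ∈ T)) (hi : i ∈ T) (hj : j ∈ T) :
    g (crossing v φ c i j) - e = 0 := by
  obtain ⟨α, β, -, -, h1, -, hc⟩ := crossing_weights h
  rw [hc, map_add, map_smul, map_smul, smul_eq_mul, smul_eq_mul]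
  linear_combination α * (hg i).2.2 hi + β * (hg j).2.2 hj + e * h1

/-- A crossing point lies on no face that misses an endpoint of its segment. -/
theorem mem_face_of_crossing {i j : ι} (h : (φ (v i) - c) * (φ (v j) - c) < 0)
    {g : E →ₗ[ℝ] ℝ} {e : ℝ} {T : Set ι}
    (hg : ∀ k, 0 ≤ g (v k) - e ∧ (g (v k) - e = 0 ↔ k ∈ T))
    (hx : g (crossing v φ c i j) - e = 0) : i ∈ T ∧ j ∈ T := by
  obtain ⟨α, β, hα, hβ, h1, -, hc⟩ := crossing_weights h
  rw [hc, map_add, map_smul, map_smul, smul_eq_mul, smul_eq_mul] at hx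
  have h2 := mul_nonneg hα.le (hg i).1
  have h3 := mul_nonneg hβ.le (hg j).1
  have h4 : α * (g (v i) - e) + β * (g (v j) - e) = 0 := by linear_combination hx - e * h1
  constructor
  · exact (hg i).2.1 ((mul_eq_zero.1 (by linarith : α * (g (v i) - e) = 0)).resolve_left hα.ne')
  · exact (hg j).2.1 ((mul_eq_zero.1 (by linarith : β * (g (v j) - e) = 0)).resolve_left hβ.ne')

variable [Fintype ι]

theorem mem_convexHull_range_iff {x : E} :
    x ∈ convexHull ℝ (Set.range v) ↔
      ∃ w : ι → ℝ, (∀ k, 0 ≤ w k) ∧ ∑ k, w k = 1 ∧ ∑ k, w k • v k = x := by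
  classical
  constructor
  · intro hx
    rw [convexHull_range_eq_exists_affineCombination] at hx
    obtain ⟨s, w, hw0, hw1, rfl⟩ := hx
    refine ⟨fun k => if k ∈ s then w k else 0, fun k => ?_, ?_, ?_⟩
    · dsimp only
      split_ifs with h
      exacts [hw0 k h, le_rfl]
    · simpa using hw1
    · rw [Finset.affineCombination_eq_linear_combination _ _ _ hw1]
      simp [ite_smul]
  · rintro ⟨w, hw0, hw1, rfl⟩
    exact (convex_convexHull ℝ _).sum_mem (fun k _ => hw0 k) hw1
      fun k _ => subset_convexHull ℝ _ ⟨k, rfl⟩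

theorem map_weighted_sum_sub (φ : E →ₗ[ℝ] ℝ) (c : ℝ) (v : ι → E) {w : ι → ℝ}
    (hw : ∑ k, w k = 1) : φ (∑ k, w k • v k) - c = ∑ k, w k * (φ (v k) - c) := by
  simp only [map_sum, map_smul, smul_eq_mul, mul_sub, Finset.sum_sub_distrib, ← Finset.sum_mul,
    hw, one_mul]

/-- A point of the slice carrying three positive weights is not extreme: three weights can be moved
within the two linear constraints "total weight `1`" and "`φ = c`", and the point moves along. -/
theorem not_extreme_of_three_weights (h3 : NoThreeDependent v) {w : ι → ℝ} (hw0 : ∀ k, 0 ≤ w k)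
    (hw1 : ∑ k, w k = 1) {p q r : ι} (hpq : p ≠ q) (hpr : p ≠ r) (hqr : q ≠ r)
    (hp : 0 < w p) (hq : 0 < w q) (hr : 0 < w r) :
    ∑ k, w k • v k ∉ Set.extremePoints ℝ ({x | φ x = c} ∩ convexHull ℝ (Set.range v)) := by
  classical
  intro hx
  set f : ι → ℝ := fun k => φ (v k) - c with hf
  -- the direction `(α, β, γ)` is orthogonal to `(1, 1, 1)` and to `(f p, f q, f r)`
  obtain ⟨α, β, γ, h1, h2, hne⟩ : ∃ α β γ : ℝ, α + β + γ = 0 ∧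
      α * f p + β * f q + γ * f r = 0 ∧ ¬(α = 0 ∧ β = 0 ∧ γ = 0) := by
    by_cases h : f p = f q ∧ f q = f r
    · exact ⟨1, -1, 0, by ring, by rw [h.1]; ring, by norm_num⟩
    · refine ⟨f q - f r, f r - f p, f p - f q, by ring, by ring, fun h' => h ⟨?_, ?_⟩⟩
      · linarith [h'.2.2]
      · linarith [h'.1]
  apply hne
  apply h3 p q r hpq hpr hqr α β γ h1
  set D : E := α • v p + β • v q + γ • v r with hD
  set m := min (w p) (min (w q) (w r)) with hm
  have hm0 : 0 < m := lt_min hp (lt_min hq hr)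
  set M := 1 + |α| + |β| + |γ| with hM
  have hM0 : 0 < M := by positivity
  set ε := m / M with hε
  have hε0 : 0 < ε := div_pos hm0 hM0
  have hεM : ε * M = m := by rw [hε]; field_simp
  -- moving by `s` with `|s| ≤ ε` keeps the weights nonnegative
  have key : ∀ s : ℝ, |s| ≤ ε →
      ∑ k, w k • v k + s • D ∈ {x | φ x = c} ∩ convexHull ℝ (Set.range v) := by
    intro s hs
    set δ : ι → ℝ := Pi.single p α + Pi.single q β + Pi.single r γ with hδ
    have hδsum : ∑ k, δ k = 0 := by
      simp [hδ, Finset.sum_add_distrib, h1]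
    have hδv : ∑ k, δ k • v k = D := by
      simp [hδ, hD, Finset.sum_add_distrib, add_smul, Pi.single_apply, ite_smul]
    have hbound : ∀ k, ∀ a : ℝ, |a| ≤ M → m ≤ w k → 0 ≤ w k + s * a := by
      intro k a ha hk
      have : |s * a| ≤ m := by
        rw [abs_mul, ← hεM]
        exact mul_le_mul hs ha (abs_nonneg _) hε0.le
      linarith [neg_abs_le (s * a)]
    have hw0' : ∀ k, 0 ≤ w k + s * δ k := by
      intro k
      by_cases kp : k = p
      · subst kp
        have : δ k = α := by simp [hδ, hpq, hpr]
        rw [this]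
        exact hbound k α (by rw [hM]; linarith [abs_nonneg β, abs_nonneg γ]) (min_le_left _ _)
      by_cases kq : k = q
      · subst kq
        have : δ k = β := by simp [hδ, hpq.symm, hqr]
        rw [this]
        exact hbound k β (by rw [hM]; linarith [abs_nonneg α, abs_nonneg γ])
          ((min_le_right _ _).trans (min_le_left _ _))
      by_cases kr : k = r
      · subst kr
        have : δ k = γ := by simp [hδ, hpr.symm, hqr.symm]
        rw [this]
        exact hbound k γ (by rw [hM]; linarith [abs_nonneg α, abs_nonneg β])
          ((min_le_right _ _).trans (min_le_right _ _))
      have : δ k = 0 := by simp [hδ, kp, kq, kr]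
      rw [this]
      simpa using hw0 k
    refine ⟨?_, mem_convexHull_range_iff.2 ⟨fun k => w k + s * δ k, hw0', ?_, ?_⟩⟩
    · have hxH : φ (∑ k, w k • v k) = c := hx.1.1
      have hDφ : φ D = 0 := by
        have : φ D = α * f p + β * f q + γ * f r + (α + β + γ) * c := by
          simp only [hD, hf, map_add, map_smul, smul_eq_mul]
          ring
        rw [this, h1, h2]
        ring
      simp only [Set.mem_ofPred_eq, map_add, map_smul, hxH, hDφ, smul_zero, add_zero]
    · rw [Finset.sum_add_distrib, ← Finset.mul_sum, hδsum, hw1]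
      ring
    · simp only [add_smul, Finset.sum_add_distrib, mul_smul, ← Finset.smul_sum, hδv]
  have hmove := (mem_extremePoints_iff_left.1 hx).2 _ (key ε (abs_of_pos hε0).le) _
    (key (-ε) (by rw [abs_neg, abs_of_pos hε0])) ⟨1 / 2, 1 / 2, by norm_num, by norm_num,
      by norm_num, by module⟩
  have : ε • D = 0 := by simpa using hmove
  exact (smul_eq_zero.1 this).resolve_left hε0.ne'

/-- Points of a face are convex combinations of the points indexed by that face. -/
theorem weight_eq_zero_of_face {g : E →ₗ[ℝ] ℝ} {e : ℝ} {T : Set ι}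
    (hg : ∀ k, 0 ≤ g (v k) - e ∧ (g (v k) - e = 0 ↔ k ∈ T)) {w : ι → ℝ} (hw0 : ∀ k, 0 ≤ w k)
    (hw1 : ∑ k, w k = 1) (hx : g (∑ k, w k • v k) - e = 0) {k : ι} (hk : k ∉ T) : w k = 0 := by
  rw [map_weighted_sum_sub g e v hw1,
    Finset.sum_eq_zero_iff_of_nonneg fun k _ => mul_nonneg (hw0 k) (hg k).1] at hx
  have := hx k (Finset.mem_univ k)
  rcases mul_eq_zero.1 this with h | h
  · exact h
  · exact absurd ((hg k).2.1 h) hk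

theorem face_nonneg {g : E →ₗ[ℝ] ℝ} {e : ℝ} {T : Set ι}
    (hg : ∀ k, 0 ≤ g (v k) - e ∧ (g (v k) - e = 0 ↔ k ∈ T)) {x : E}
    (hx : x ∈ convexHull ℝ (Set.range v)) : 0 ≤ g x - e := by
  obtain ⟨w, hw0, hw1, rfl⟩ := mem_convexHull_range_iff.1 hx
  rw [map_weighted_sum_sub g e v hw1]
  exact Finset.sum_nonneg fun k _ => mul_nonneg (hw0 k) (hg k).1

theorem face_of_openSegment {g : E →ₗ[ℝ] ℝ} {e : ℝ} {T : Set ι}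
    (hg : ∀ k, 0 ≤ g (v k) - e ∧ (g (v k) - e = 0 ↔ k ∈ T)) {x y z : E}
    (hx : x ∈ convexHull ℝ (Set.range v)) (hy : y ∈ convexHull ℝ (Set.range v))
    (hz : z ∈ openSegment ℝ x y) (hgz : g z - e = 0) : g x - e = 0 := by
  obtain ⟨a, b, ha, hb, hab, rfl⟩ := hz
  rw [map_add, map_smul, map_smul, smul_eq_mul, smul_eq_mul] at hgz
  have : a * (g x - e) + b * (g y - e) = 0 := by linear_combination hgz - e * hab
  have h1 := mul_nonneg ha.le (face_nonneg hg hx)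
  have h2 := mul_nonneg hb.le (face_nonneg hg hy)
  exact (mul_eq_zero.1 (by linarith : a * (g x - e) = 0)).resolve_left ha.ne'

theorem mem_segment_of_face {g : E →ₗ[ℝ] ℝ} {e : ℝ} {i j : ι} (hij : i ≠ j)
    (hg : ∀ k, 0 ≤ g (v k) - e ∧ (g (v k) - e = 0 ↔ k ∈ ({i, j} : Set ι))) {x : E}
    (hx : x ∈ convexHull ℝ (Set.range v)) (hgx : g x - e = 0) :
    ∃ α β : ℝ, α + β = 1 ∧ x = α • v i + β • v j := by
  classical
  obtain ⟨w, hw0, hw1, rfl⟩ := mem_convexHull_range_iff.1 hx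
  have hz : ∀ k, k ≠ i ∧ k ≠ j → w k = 0 := fun k hk =>
    weight_eq_zero_of_face hg hw0 hw1 hgx (by simpa using hk)
  refine ⟨w i, w j, ?_, ?_⟩
  · rw [← hw1, Fintype.sum_eq_add i j hij hz]
  · rw [Fintype.sum_eq_add i j hij fun k hk => by rw [hz k hk, zero_smul]]

/-- If `[v i, v j]` is an edge crossed by the hyperplane, the crossing point is a vertex of the
slice. -/
theorem crossing_mem_extremePoints {i j : ι} (hij : i ≠ j) (hE : IsFaceIndex v {i, j})
    (h : (φ (v i) - c) * (φ (v j) - c) < 0) :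
    crossing v φ c i j ∈ Set.extremePoints ℝ ({x | φ x = c} ∩ convexHull ℝ (Set.range v)) := by
  obtain ⟨g, e, hg⟩ := hE
  refine mem_extremePoints_iff_left.2 ⟨crossing_mem_slice h, ?_⟩
  rintro x ⟨hxφ, hxP⟩ y ⟨hyφ, hyP⟩ ⟨a, b, ha, hb, hab, hxy⟩
  have hgc := crossing_mem_face h hg (by simp) (by simp)
  have hgx := face_of_openSegment hg hxP hyP ⟨a, b, ha, hb, hab, hxy⟩ hgc
  obtain ⟨α, β, h1, rfl⟩ := mem_segment_of_face hij hg hxP hgx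
  refine eq_crossing h h1 ?_
  have : φ (α • v i + β • v j) = c := hxφ
  simp only [map_add, map_smul, smul_eq_mul] at this
  linear_combination this - c * h1

theorem vertex_mem_extremePoints {i : ι} (hV : IsFaceIndex v {i}) (h : φ (v i) - c = 0) :
    v i ∈ Set.extremePoints ℝ ({x | φ x = c} ∩ convexHull ℝ (Set.range v)) := by
  classical
  obtain ⟨g, e, hg⟩ := hV
  refine mem_extremePoints_iff_left.2
    ⟨⟨sub_eq_zero.1 h, subset_convexHull ℝ _ ⟨i, rfl⟩⟩, ?_⟩
  rintro x ⟨-, hxP⟩ y ⟨-, hyP⟩ ⟨a, b, ha, hb, hab, hxy⟩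
  have hgi : g (v i) - e = 0 := (hg i).2.2 rfl
  have hgx := face_of_openSegment hg hxP hyP ⟨a, b, ha, hb, hab, hxy⟩ hgi
  obtain ⟨w, hw0, hw1, rfl⟩ := mem_convexHull_range_iff.1 hxP
  have hz : ∀ k, k ≠ i → w k = 0 := fun k hk =>
    weight_eq_zero_of_face hg hw0 hw1 hgx (by simpa using hk)
  rw [Fintype.sum_eq_single i hz] at hw1
  rw [Fintype.sum_eq_single i fun k hk => by rw [hz k hk, zero_smul], hw1, one_smul]

/-- An extreme point of the slice is one of the given points on the hyperplane or a crossing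
point. -/
theorem extremePoints_slice_cases [LinearOrder ι] (h3 : NoThreeDependent v) {x : E}
    (hx : x ∈ Set.extremePoints ℝ ({x | φ x = c} ∩ convexHull ℝ (Set.range v))) :
    (∃ k, φ (v k) - c = 0 ∧ x = v k) ∨
      ∃ i j, i < j ∧ (φ (v i) - c) * (φ (v j) - c) < 0 ∧ x = crossing v φ c i j := by
  classical
  obtain ⟨w, hw0, hw1, rfl⟩ := mem_convexHull_range_iff.1 hx.1.2
  have hφ : ∑ k, w k * (φ (v k) - c) = 0 := by
    rw [← map_weighted_sum_sub φ c v hw1, sub_eq_zero]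
    exact hx.1.1
  obtain ⟨p, hp⟩ : ∃ p, w p ≠ 0 := by
    by_contra! h
    simp [h] at hw1
  by_cases hq : ∃ q, q ≠ p ∧ w q ≠ 0
  · obtain ⟨q, hqp, hq⟩ := hq
    have hz : ∀ k, k ≠ p ∧ k ≠ q → w k = 0 := by
      rintro k ⟨hkp, hkq⟩
      by_contra hk
      exact not_extreme_of_three_weights h3 hw0 hw1 hqp.symm (Ne.symm hkp) (Ne.symm hkq)
        (lt_of_le_of_ne (hw0 p) (Ne.symm hp)) (lt_of_le_of_ne (hw0 q) (Ne.symm hq))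
        (lt_of_le_of_ne (hw0 k) (Ne.symm hk)) hx
    -- relabel the two supporting indices increasingly
    obtain ⟨i, j, hij, hi, hj, hz⟩ : ∃ i j, i < j ∧ w i ≠ 0 ∧ w j ≠ 0 ∧
        ∀ k, k ≠ i ∧ k ≠ j → w k = 0 := by
      rcases lt_or_gt_of_ne hqp with h | h
      · exact ⟨q, p, h, hq, hp, fun k hk => hz k hk.symm⟩
      · exact ⟨p, q, h, hp, hq, hz⟩
    have hi0 : 0 < w i := lt_of_le_of_ne (hw0 i) (Ne.symm hi)
    have hj0 : 0 < w j := lt_of_le_of_ne (hw0 j) (Ne.symm hj)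
    rw [Fintype.sum_eq_add i j hij.ne hz] at hw1
    rw [Fintype.sum_eq_add i j hij.ne fun k hk => by rw [hz k hk, zero_mul]] at hφ
    rw [Fintype.sum_eq_add i j hij.ne fun k hk => by rw [hz k hk, zero_smul]] at hx ⊢
    by_cases hi' : φ (v i) - c = 0
    · -- both ends lie on the hyperplane, so the point is not extreme
      have hj' : φ (v j) - c = 0 := by
        rw [hi', mul_zero, zero_add] at hφ
        exact (mul_eq_zero.1 hφ).resolve_left hj0.ne'
      have := (mem_extremePoints.1 hx).2 (v i)
        ⟨sub_eq_zero.1 hi', subset_convexHull ℝ _ ⟨i, rfl⟩⟩ (v j)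
        ⟨sub_eq_zero.1 hj', subset_convexHull ℝ _ ⟨j, rfl⟩⟩ ⟨w i, w j, hi0, hj0, hw1, rfl⟩
      exact .inl ⟨i, hi', this.1.symm⟩
    · right
      have hneg : (φ (v i) - c) * (φ (v j) - c) < 0 := by
        have : w j * ((φ (v i) - c) * (φ (v j) - c)) = -(w i * (φ (v i) - c) ^ 2) := by
          linear_combination (φ (v i) - c) * hφ
        have h2 : 0 < w i * (φ (v i) - c) ^ 2 := by positivity
        by_contra! h
        have := mul_nonneg hj0.le h
        linarith
      exact ⟨i, j, hij, hneg, eq_crossing hneg hw1 hφ⟩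
  · push Not at hq
    left
    rw [Fintype.sum_eq_single p hq] at hw1
    rw [Fintype.sum_eq_single p fun k hk => by rw [hq k hk, zero_mul], hw1, one_mul] at hφ
    refine ⟨p, hφ, ?_⟩
    rw [Fintype.sum_eq_single p fun k hk => by rw [hq k hk, zero_smul], hw1, one_smul]

/-- **Vertex count of a slice.** If the edges of a polytope, all of whose points `v k` are vertices,
are the pairs `i < j` with `Edge i j`, a slice has one vertex for each vertex on the hyperplane and
one for each edge crossed by it. That a pair is no edge enters through convex combinations
representing the inner points of the segment with a further positive weight. -/
theorem ncard_extremePoints_slice [LinearOrder ι] (h3 : NoThreeDependent v)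
    (hV : ∀ k, IsFaceIndex v {k}) (Edge : ι → ι → Prop)
    (hE : ∀ i j, i < j → Edge i j → IsFaceIndex v {i, j})
    (hN : ∀ i j, i < j → ¬Edge i j → ∀ α β : ℝ, 0 < α → 0 < β → α + β = 1 →
      ∃ w : ι → ℝ, (∀ k, 0 ≤ w k) ∧ ∑ k, w k = 1 ∧ ∑ k, w k • v k = α • v i + β • v j ∧
        0 < w i ∧ 0 < w j ∧ ∃ k, k ≠ i ∧ k ≠ j ∧ 0 < w k) :
    (Set.extremePoints ℝ ({x | φ x = c} ∩ convexHull ℝ (Set.range v))).ncard =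
      {k | φ (v k) - c = 0}.ncard +
      {p : ι × ι | p.1 < p.2 ∧ Edge p.1 p.2 ∧
        (φ (v p.1) - c) * (φ (v p.2) - c) < 0}.ncard := by
  set Z : Set ι := {k | φ (v k) - c = 0} with hZ
  set X : Set (ι × ι) := {p | p.1 < p.2 ∧ Edge p.1 p.2 ∧
    (φ (v p.1) - c) * (φ (v p.2) - c) < 0} with hX
  have hset : Set.extremePoints ℝ ({x | φ x = c} ∩ convexHull ℝ (Set.range v)) =
      v '' Z ∪ (fun p : ι × ι => crossing v φ c p.1 p.2) '' X := by
    apply Set.Subset.antisymm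
    · intro x hx
      rcases extremePoints_slice_cases h3 hx with ⟨k, hk, rfl⟩ | ⟨i, j, hij, hneg, rfl⟩
      · exact .inl ⟨k, hk, rfl⟩
      · refine .inr ⟨(i, j), ⟨hij, ?_, hneg⟩, rfl⟩
        by_contra hne
        obtain ⟨α, β, hα, hβ, h1, -, hc⟩ := crossing_weights hneg
        obtain ⟨w, hw0, hw1, hwx, hwi, hwj, k, hki, hkj, hwk⟩ := hN i j hij hne α β hα hβ h1
        rw [hc, ← hwx] at hx
        exact not_extreme_of_three_weights h3 hw0 hw1 hij.ne hki.symm hkj.symm hwi hwj hwk hx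
    · rintro x (⟨k, hk, rfl⟩ | ⟨p, ⟨hp, hpE, hneg⟩, rfl⟩)
      · exact vertex_mem_extremePoints (hV k) hk
      · exact crossing_mem_extremePoints hp.ne (hE _ _ hp hpE) hneg
  have hvinj : Function.Injective v := by
    intro k l hkl
    obtain ⟨g, e, hg⟩ := hV k
    exact ((hg l).2.1 (by rw [← hkl]; exact (hg k).2.2 rfl)).symm
  have hcinj : Set.InjOn (fun p : ι × ι => crossing v φ c p.1 p.2) X := by
    rintro ⟨i, j⟩ ⟨hij, hijE, hijn⟩ ⟨k, l⟩ ⟨hkl, -, hkln⟩ heq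
    dsimp only at hij hijE hijn hkl hkln heq
    obtain ⟨g, e, hg⟩ := hE i j hij hijE
    have hgc := crossing_mem_face hijn hg (by simp) (by simp)
    rw [heq] at hgc
    have := mem_face_of_crossing hkln hg hgc
    simp only [Set.mem_insert_iff, Set.mem_singleton_iff] at this
    rcases this with ⟨rfl | rfl, rfl | rfl⟩
    · exact absurd hkl (lt_irrefl _)
    · rfl
    · exact absurd hkl hij.not_gt
    · exact absurd hkl (lt_irrefl _)
  have hdisj : Disjoint (v '' Z) ((fun p : ι × ι => crossing v φ c p.1 p.2) '' X) := by
    rw [Set.disjoint_left]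
    rintro x ⟨k, -, rfl⟩ ⟨⟨i, j⟩, ⟨hij, -, hneg⟩, heq⟩
    dsimp only at hij hneg heq
    obtain ⟨g, e, hg⟩ := hV k
    have := mem_face_of_crossing hneg hg (by rw [heq]; exact (hg k).2.2 rfl)
    exact hij.ne (this.1.trans this.2.symm)
  rw [hset, Set.ncard_union_eq hdisj (Set.toFinite _) (Set.toFinite _),
    Set.ncard_image_of_injective _ hvinj, hcinj.ncard_image]

end Slice

/-! ### Hyperplane sections of the moment curve as polynomials -/

open Polynomial in
theorem inner_momentCurve {d : ℕ} (p : ℝ[X]) (hp : p.natDegree ≤ d) (s : ℝ) :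
    inner ℝ (WithLp.toLp 2 fun j : Fin d => p.coeff (j + 1) : EuclideanSpace ℝ (Fin d))
      (momentCurve d s) - -p.coeff 0 = p.eval s := by
  rw [Polynomial.eval_eq_sum_range' (Nat.lt_succ_of_le hp), Finset.sum_range_succ',
    ← Fin.sum_univ_eq_sum_range (fun i => p.coeff (i + 1) * s ^ (i + 1)) d]
  simp [PiLp.inner_apply, momentCurve, mul_comm]

open Polynomial in
theorem exists_polynomial_eval_eq {d : ℕ} (u : EuclideanSpace ℝ (Fin d)) (c : ℝ) :
    ∃ p : ℝ[X], p.natDegree ≤ d ∧ (∀ j : Fin d, p.coeff (j + 1) = u j) ∧ p.coeff 0 = -c := by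
  refine ⟨∑ j : Fin d, C (u j) * X ^ ((j : ℕ) + 1) - C c, ?_, fun j => ?_, ?_⟩
  · refine (natDegree_sub_le _ _).trans (max_le (natDegree_sum_le_of_forall_le _ _ fun j _ => ?_)
      ((natDegree_C c).le.trans (Nat.zero_le _)))
    exact (natDegree_C_mul_X_pow_le _ _).trans j.2
  · simp [coeff_C_succ, coeff_X_pow, Fin.val_inj]
  · simp [coeff_X_pow]

open Polynomial in
/-- A nonnegative polynomial on the parameters exhibits the points at its zeros as a face. -/
theorem isFaceIndex_momentCurve {d n : ℕ} {t : Fin n → ℝ} {T : Set (Fin n)} (q : ℝ[X])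
    (hq : q.natDegree ≤ d) (h : ∀ k, 0 ≤ q.eval (t k) ∧ (q.eval (t k) = 0 ↔ k ∈ T)) :
    IsFaceIndex (fun k => momentCurve d (t k)) T :=
  ⟨innerₗ _ (WithLp.toLp 2 fun j : Fin d => q.coeff (j + 1) : EuclideanSpace ℝ (Fin d)),
    -q.coeff 0, fun k => by
      rw [innerₗ_apply_apply, inner_momentCurve q hq]
      exact h k⟩

open Polynomial in
/-- Affine relations between points of the moment curve are inherited by the values of any
polynomial of degree at most `d`. -/
theorem sum_mul_eval_eq_zero {d : ℕ} {ι : Type*} [Fintype ι] {s : ι → ℝ} {w : ι → ℝ}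
    (h0 : ∑ k, w k = 0) (h : ∑ k, w k • momentCurve d (s k) = 0) (q : ℝ[X])
    (hq : q.natDegree ≤ d) : ∑ k, w k * q.eval (s k) = 0 := by
  have := congrArg (inner ℝ (WithLp.toLp 2 fun j : Fin d => q.coeff (j + 1) :
    EuclideanSpace ℝ (Fin d))) h
  rw [inner_sum, inner_zero_right] at this
  simp only [inner_smul_right] at this
  simp only [← inner_momentCurve q hq, mul_sub, Finset.sum_sub_distrib, this, ← Finset.sum_mul,
    h0]
  ring

open Polynomial in
theorem noThreeDependent_momentCurve {d n : ℕ} (hd : 2 ≤ d) {t : Fin n → ℝ}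
    (ht : Function.Injective t) : NoThreeDependent (fun k => momentCurve d (t k)) := by
  intro a b c hab hac hbc α β γ h0 h
  have key : ∀ x y : ℝ, α * ((t a - x) * (t a - y)) + β * ((t b - x) * (t b - y)) +
      γ * ((t c - x) * (t c - y)) = 0 := by
    intro x y
    have := sum_mul_eval_eq_zero (d := d) (s := ![t a, t b, t c]) (w := ![α, β, γ])
      (by simpa [Fin.sum_univ_three] using h0) (by simpa [Fin.sum_univ_three] using h)
      ((X - C x) * (X - C y))
      ((natDegree_mul_le.trans (by simp)).trans hd)
    simpa [Fin.sum_univ_three] using this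
  have hne : ∀ {x y z : Fin n}, x ≠ y → x ≠ z → (t x - t y) * (t x - t z) ≠ 0 := fun h h' =>
    mul_ne_zero (sub_ne_zero.2 (ht.ne h)) (sub_ne_zero.2 (ht.ne h'))
  refine ⟨?_, ?_, ?_⟩
  · have := key (t b) (t c)
    simp only [sub_self, zero_mul, mul_zero, add_zero] at this
    exact (mul_eq_zero.1 this).resolve_right (hne hab hac)
  · have := key (t a) (t c)
    simp only [sub_self, zero_mul, mul_zero, add_zero, zero_add] at this
    exact (mul_eq_zero.1 this).resolve_right (hne hab.symm hbc)
  · have := key (t a) (t b)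
    simp only [sub_self, zero_mul, mul_zero, zero_add] at this
    exact (mul_eq_zero.1 this).resolve_right (hne hac.symm hbc.symm)

/-- The number of vertices of a slice whose hyperplane takes the values `f k` at the vertices of a
polytope with edges `Edge`: the vertices on the hyperplane and the edges crossed by it. -/
noncomputable def signCount {n : ℕ} (Edge : Fin n → Fin n → Prop) (f : Fin n → ℝ) : ℕ :=
  {k | f k = 0}.ncard + {p : Fin n × Fin n | p.1 < p.2 ∧ Edge p.1 p.2 ∧ f p.1 * f p.2 < 0}.ncard

open Polynomial in
theorem mem_vertexSliceSequence_iff {d n : ℕ} (hd : 2 ≤ d) {t : Fin n → ℝ}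
    (ht : Function.Injective t) (Edge : Fin n → Fin n → Prop)
    (hE : ∀ i j, i < j → Edge i j → ∃ q : ℝ[X], q.natDegree ≤ d ∧
      ∀ k, 0 ≤ q.eval (t k) ∧ (q.eval (t k) = 0 ↔ k = i ∨ k = j))
    (hN : ∀ i j, i < j → ¬Edge i j → ∀ α β : ℝ, 0 < α → 0 < β → α + β = 1 →
      ∃ w : Fin n → ℝ, (∀ k, 0 ≤ w k) ∧ ∑ k, w k = 1 ∧
        ∑ k, w k • momentCurve d (t k) = α • momentCurve d (t i) + β • momentCurve d (t j) ∧
        0 < w i ∧ 0 < w j ∧ ∃ k, k ≠ i ∧ k ≠ j ∧ 0 < w k) (m : ℕ) :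
    m ∈ vertexSliceSequence (cyclicPolytope d t) ↔
      0 < m ∧ ∃ p : ℝ[X], 0 < p.natDegree ∧ p.natDegree ≤ d ∧
        m = signCount Edge (fun k => p.eval (t k)) := by
  have h3 := noThreeDependent_momentCurve hd ht
  have hV : ∀ k, IsFaceIndex (fun k => momentCurve d (t k)) {k} := fun k =>
    isFaceIndex_momentCurve ((X - C (t k)) ^ 2)
      ((natDegree_pow_le.trans (by simp)).trans hd) fun l => by
        simp only [eval_pow, eval_sub, eval_X, eval_C, Set.mem_singleton_iff]
        exact ⟨sq_nonneg _, by rw [sq_eq_zero_iff, sub_eq_zero, ht.eq_iff]⟩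
  have hE' : ∀ i j, i < j → Edge i j → IsFaceIndex (fun k => momentCurve d (t k)) {i, j} := by
    intro i j hij h
    obtain ⟨q, hq, hk⟩ := hE i j hij h
    exact isFaceIndex_momentCurve q hq hk
  have hcount : ∀ (u : EuclideanSpace ℝ (Fin d)) (c : ℝ),
      sliceVertexCount (cyclicPolytope d t) {x | inner ℝ u x = c} =
        signCount Edge (fun k => inner ℝ u (momentCurve d (t k)) - c) := fun u c =>
    ncard_extremePoints_slice (φ := innerₗ (EuclideanSpace ℝ (Fin d)) u) (c := c) h3 hV Edge hE' hN
  -- a slice is compact and has finitely many extreme points, so it is nonempty iff it has a vertex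
  have hpos : ∀ (u : EuclideanSpace ℝ (Fin d)) (c : ℝ),
      ({x | inner ℝ u x = c} ∩ cyclicPolytope d t).Nonempty ↔
        0 < sliceVertexCount (cyclicPolytope d t) {x | inner ℝ u x = c} := by
    intro u c
    have hfin : (Set.extremePoints ℝ ({x | inner ℝ u x = c} ∩ cyclicPolytope d t)).Finite := by
      refine ((Set.finite_range fun k => momentCurve d (t k)).union (Set.finite_range
        fun p : Fin n × Fin n => crossing (fun k => momentCurve d (t k))
          (innerₗ (EuclideanSpace ℝ (Fin d)) u) c p.1 p.2)).subset fun x hx => ?_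
      rcases extremePoints_slice_cases (φ := innerₗ (EuclideanSpace ℝ (Fin d)) u) (c := c) h3 hx with
        ⟨k, -, rfl⟩ | ⟨i, j, -, -, rfl⟩
      · exact .inl ⟨k, rfl⟩
      · exact .inr ⟨(i, j), rfl⟩
    rw [sliceVertexCount, Set.ncard_pos hfin]
    refine ⟨fun h => IsCompact.extremePoints_nonempty ?_ h, fun ⟨x, hx⟩ => ⟨x, hx.1⟩⟩
    have hc : IsCompact (cyclicPolytope d t) :=
      (Set.finite_range fun k => momentCurve d (t k)).isCompact_convexHull ℝ
    exact hc.inter_left (isClosed_eq (by fun_prop) continuous_const)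
  constructor
  · rintro ⟨_, ⟨u, c, hu, rfl⟩, hne, rfl⟩
    refine ⟨(hpos u c).1 hne, ?_⟩
    obtain ⟨p, hp, hpu, hpc⟩ := exists_polynomial_eval_eq u c
    refine ⟨p, ?_, hp, ?_⟩
    · by_contra h0
      apply hu
      ext j
      rw [← hpu j, coeff_eq_zero_of_natDegree_lt (by omega)]
      rfl
    · rw [hcount]
      congr 1
      ext k
      rw [← inner_momentCurve p hp, hpc, neg_neg]
      congr 2
      ext j
      exact (hpu j).symm
  · rintro ⟨hm, p, hp0, hp, rfl⟩
    have hval : (fun k => p.eval (t k)) = fun k => inner ℝ (WithLp.toLp 2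
        fun j : Fin d => p.coeff (j + 1) : EuclideanSpace ℝ (Fin d)) (momentCurve d (t k)) -
          -p.coeff 0 := by
      ext k
      rw [inner_momentCurve p hp]
    rw [hval, ← hcount] at hm ⊢
    refine ⟨_, ⟨_, _, fun h0 => ?_, rfl⟩, (hpos _ _).2 hm, rfl⟩
    -- the leading coefficient of `p` is a coordinate of the normal vector
    have := congrArg (fun z : EuclideanSpace ℝ (Fin d) => z ⟨p.natDegree - 1, by omega⟩) h0
    simp only [PiLp.zero_apply, Nat.sub_add_cancel hp0, coeff_natDegree,
      leadingCoeff_eq_zero] at this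
    rw [this, natDegree_zero] at hp0
    exact lt_irrefl _ hp0

/-! ### Sign patterns of polynomials along increasing parameters -/

theorem exists_separator {n : ℕ} {t : Fin n → ℝ} (ht : StrictMono t) {b : ℕ} (hb : 0 < b)
    (hbn : b < n) : ∃ s : ℝ, ∀ k : Fin n, ((k : ℕ) < b → t k < s) ∧ (b ≤ (k : ℕ) → s < t k) := by
  have hlt : t ⟨b - 1, by omega⟩ < t ⟨b, hbn⟩ := ht (by rw [Fin.lt_def]; dsimp only; omega)
  refine ⟨(t ⟨b - 1, by omega⟩ + t ⟨b, hbn⟩) / 2, fun k => ⟨fun hk => ?_, fun hk => ?_⟩⟩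
  · have : t k ≤ t ⟨b - 1, by omega⟩ := ht.monotone (by rw [Fin.le_def]; dsimp only; omega)
    linarith
  · have : t ⟨b, hbn⟩ ≤ t k := ht.monotone (by rw [Fin.le_def]; exact hk)
    linarith

theorem ncard_fin_interval {n l r : ℕ} (hr : r ≤ n) :
    {k : Fin n | l ≤ (k : ℕ) ∧ (k : ℕ) < r}.ncard = r - l := by
  have : Fin.val '' {k : Fin n | l ≤ (k : ℕ) ∧ (k : ℕ) < r} = (Finset.Ico l r : Set ℕ) := by
    ext x
    simp only [Set.mem_image, Set.mem_ofPred_eq, Finset.coe_Ico, Set.mem_Ico]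
    constructor
    · rintro ⟨k, hk, rfl⟩
      exact hk
    · intro hx
      exact ⟨⟨x, by omega⟩, hx, rfl⟩
  rw [← Set.ncard_image_of_injective _ Fin.val_injective, this, Set.ncard_coe_finset, Nat.card_Ico]

theorem ncard_zero_add_pos_add_neg {n : ℕ} (f : Fin n → ℝ) :
    {k | 0 < f k}.ncard + {k | f k < 0}.ncard + {k | f k = 0}.ncard = n := by
  have h1 : Disjoint {k | 0 < f k} {k | f k < 0} := by
    rw [Set.disjoint_left]
    exact fun k (h : 0 < f k) h' => lt_asymm h h'
  have h2 : Disjoint ({k | 0 < f k} ∪ {k | f k < 0}) {k | f k = 0} := by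
    rw [Set.disjoint_left]
    rintro k (h | h) h'
    exacts [h.ne' h', h.ne h']
  rw [← Set.ncard_union_eq h1, ← Set.ncard_union_eq h2]
  have : {k | 0 < f k} ∪ {k | f k < 0} ∪ {k | f k = 0} = Set.univ := by
    ext k
    simp only [Set.mem_union, Set.mem_ofPred_eq, Set.mem_univ, iff_true]
    rcases lt_trichotomy (f k) 0 with h | h | h <;> simp [h]
  rw [this, Set.ncard_univ, Nat.card_fin]

open Polynomial in
/-- A polynomial of degree `i ≥ 1` (or `1`, if `i = 0`) with `i` zeros, `b` negative values and
`a` positive values at the parameters. -/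
theorem exists_polynomial_signs {n : ℕ} {t : Fin n → ℝ} (ht : StrictMono t) {a b i : ℕ}
    (ha : a + 1 ≤ n) (hb : b + 1 ≤ n) (h : a + b + i = n) :
    ∃ p : ℝ[X], 0 < p.natDegree ∧ p.natDegree ≤ max i 1 ∧ {k | 0 < p.eval (t k)}.ncard = a ∧
      {k | p.eval (t k) < 0}.ncard = b ∧ {k | p.eval (t k) = 0}.ncard = i := by
  -- it suffices to have the negative values and the positive ones in intervals of indices
  suffices H : ∃ p : ℝ[X], 0 < p.natDegree ∧ p.natDegree ≤ max i 1 ∧ ∃ l, l + b ≤ n - a ∧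
      ∀ k : Fin n, (p.eval (t k) < 0 ↔ l ≤ (k : ℕ) ∧ (k : ℕ) < l + b) ∧
        (0 < p.eval (t k) ↔ n - a ≤ (k : ℕ)) by
    obtain ⟨p, h0, hp, l, hl, hk⟩ := H
    have h1 : {k | 0 < p.eval (t k)}.ncard = a := by
      have : {k | 0 < p.eval (t k)} = {k : Fin n | n - a ≤ (k : ℕ) ∧ (k : ℕ) < n} := by
        ext k
        simp [(hk k).2]
      rw [this, ncard_fin_interval le_rfl]
      omega
    have h2 : {k | p.eval (t k) < 0}.ncard = b := by
      have : {k | p.eval (t k) < 0} = {k : Fin n | l ≤ (k : ℕ) ∧ (k : ℕ) < l + b} := by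
        ext k
        simp [(hk k).1]
      rw [this, ncard_fin_interval (by omega)]
      omega
    have := ncard_zero_add_pos_add_neg fun k => p.eval (t k)
    exact ⟨p, h0, hp, h1, h2, by omega⟩
  rcases Nat.eq_zero_or_pos i with rfl | hi
  · obtain ⟨s, hs⟩ := exists_separator ht (b := b) (by omega) (by omega)
    refine ⟨X - C s, by simp, by simp, 0, by omega, fun k => ?_⟩
    simp only [eval_sub, eval_X, eval_C, sub_neg, sub_pos]
    rcases lt_or_ge (k : ℕ) b with hk | hk
    · have := (hs k).1 hk
      exact ⟨⟨fun _ => by omega, fun _ => this⟩, ⟨fun h' => absurd h' this.not_gt,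
        fun _ => by omega⟩⟩
    · have := (hs k).2 hk
      exact ⟨⟨fun h' => absurd h' this.not_gt, fun _ => by omega⟩, ⟨fun _ => by omega,
        fun _ => this⟩⟩
  -- simple zeros at an odd number of consecutive parameters separate the signs
  have block : ∀ l r : ℕ, l ≤ r → r ≤ n → Odd (r - l) → ∃ p : ℝ[X], p.natDegree = r - l ∧
      ∀ k : Fin n, ((k : ℕ) < l → p.eval (t k) < 0) ∧ (r ≤ (k : ℕ) → 0 < p.eval (t k)) ∧
        (l ≤ (k : ℕ) → (k : ℕ) < r → p.eval (t k) = 0) := by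
    intro l r hlr hrn hodd
    set S : Finset (Fin n) := {k | l ≤ (k : ℕ) ∧ (k : ℕ) < r} with hS
    have hcard : S.card = r - l := by
      rw [← ncard_fin_interval hrn, ← Set.ncard_coe_finset]
      congr 1
      ext k
      simp [hS]
    refine ⟨∏ k ∈ S, (X - C (t k)), by simp [hcard], fun k => ⟨fun hk => ?_, fun hk => ?_,
      fun hk hk' => ?_⟩⟩
    · have : (∏ j ∈ S, (X - C (t j))).eval (t k) = -∏ j ∈ S, (t j - t k) := by
        rw [eval_prod, ← neg_one_mul, ← (hcard ▸ hodd : Odd S.card).neg_one_pow,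
          ← Finset.prod_neg]
        simp
      rw [this, neg_lt_zero]
      refine Finset.prod_pos fun j hj => sub_pos.2 (ht (Fin.lt_def.2 ?_))
      simp only [hS, Finset.mem_filter, Finset.mem_univ, true_and] at hj
      omega
    · rw [eval_prod]
      refine Finset.prod_pos fun j hj => ?_
      simp only [eval_sub, eval_X, eval_C, sub_pos]
      refine ht (Fin.lt_def.2 ?_)
      simp only [hS, Finset.mem_filter, Finset.mem_univ, true_and] at hj
      omega
    · rw [eval_prod]
      exact Finset.prod_eq_zero (i := k) (by simp [hS, hk, hk']) (by simp)
  rcases Nat.even_or_odd i with hev | hodd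
  · -- an even number of zeros: one of them is put at the first parameter
    have hi2 : 2 ≤ i := by
      obtain ⟨r, hr⟩ := hev
      omega
    have hodd : Odd (b + i - (b + 1)) := by
      obtain ⟨r, hr⟩ := hev
      exact ⟨r - 1, by omega⟩
    obtain ⟨p, hp, hk⟩ := block (b + 1) (b + i) (by omega) (by omega) hodd
    have hp0 : p ≠ 0 := by
      rintro rfl
      rw [natDegree_zero] at hp
      omega
    have hdeg : ((X - C (t ⟨0, by omega⟩)) * p).natDegree = i := by
      rw [natDegree_mul (X_sub_C_ne_zero _) hp0, natDegree_X_sub_C, hp]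
      omega
    refine ⟨(X - C (t ⟨0, by omega⟩)) * p, by omega, by omega, 1, by omega, fun k => ?_⟩
    simp only [eval_mul, eval_sub, eval_X, eval_C]
    obtain ⟨k1, k2, k3⟩ := hk k
    rcases Nat.eq_zero_or_pos (k : ℕ) with h0 | h0
    · have : k = ⟨0, by omega⟩ := Fin.ext h0
      rw [← this, sub_self, zero_mul]
      simp only [lt_irrefl, false_iff]
      omega
    have hpos : 0 < t k - t ⟨0, by omega⟩ := sub_pos.2 (ht (Fin.lt_def.2 h0))
    have hneg : ∀ y, (t k - t ⟨0, by omega⟩) * y < 0 ↔ y < 0 := fun y =>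
      ⟨fun h => by
        by_contra! h'
        exact absurd h (mul_nonneg hpos.le h').not_gt, mul_neg_of_pos_of_neg hpos⟩
    rw [hneg, mul_pos_iff_of_pos_left hpos]
    rcases lt_or_ge (k : ℕ) (b + 1) with h1 | h1
    · have := k1 h1
      exact ⟨⟨fun _ => by omega, fun _ => this⟩, ⟨fun h' => absurd h' this.not_gt,
        fun _ => by omega⟩⟩
    rcases lt_or_ge (k : ℕ) (b + i) with h2 | h2
    · rw [k3 h1 h2]
      simp only [lt_irrefl, false_iff]
      omega
    · have := k2 h2
      exact ⟨⟨fun h' => absurd h' this.not_gt, fun _ => by omega⟩, ⟨fun _ => by omega,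
        fun _ => this⟩⟩
  · obtain ⟨p, hp, hk⟩ := block b (b + i) (by omega) (by omega) (by simpa using hodd)
    refine ⟨p, by omega, by omega, 0, by omega, fun k => ?_⟩
    obtain ⟨k1, k2, k3⟩ := hk k
    rcases lt_or_ge (k : ℕ) b with h1 | h1
    · have := k1 h1
      exact ⟨⟨fun _ => by omega, fun _ => this⟩, ⟨fun h' => absurd h' this.not_gt,
        fun _ => by omega⟩⟩
    rcases lt_or_ge (k : ℕ) (b + i) with h2 | h2
    · rw [k3 h1 h2]
      simp only [lt_irrefl, false_iff]
      omega
    · have := k2 h2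
      exact ⟨⟨fun h' => absurd h' this.not_gt, fun _ => by omega⟩, ⟨fun _ => by omega,
        fun _ => this⟩⟩

open Polynomial in
theorem ncard_eval_eq_zero_le {n : ℕ} {t : Fin n → ℝ} (ht : Function.Injective t) (p : ℝ[X])
    (hp : 0 < p.natDegree) : {k | p.eval (t k) = 0}.ncard ≤ p.natDegree := by
  have hp0 : p ≠ 0 := by
    rintro rfl
    exact lt_irrefl _ hp
  rw [← Set.ncard_image_of_injective _ ht]
  refine le_trans ?_ (p.card_roots')
  refine le_trans ?_ (Multiset.toFinset_card_le _)
  rw [← Set.ncard_coe_finset]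
  refine Set.ncard_le_ncard ?_ (Finset.finite_toSet _)
  rintro _ ⟨k, hk, rfl⟩
  simpa [hp0] using hk

/-! ### Neighbourly cyclic polytopes -/

/-- If all pairs are edges, every pair of vertices on opposite sides contributes a vertex. -/
theorem signCount_true {n : ℕ} (f : Fin n → ℝ) :
    signCount (fun _ _ => True) f =
      {k | 0 < f k}.ncard * {k | f k < 0}.ncard + {k | f k = 0}.ncard := by
  rw [signCount, add_comm, ← Set.ncard_prod]
  congr 1
  symm
  refine Set.ncard_congr (fun p _ => (min p.1 p.2, max p.1 p.2)) ?_ ?_ ?_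
  · rintro ⟨i, j⟩ ⟨hi : 0 < f i, hj : f j < 0⟩
    refine ⟨min_lt_max.2 fun h => ?_, trivial, ?_⟩
    · dsimp only at h
      exact absurd hi (h ▸ hj).not_gt
    · rcases le_total i j with h | h
      · simpa [h] using mul_neg_of_pos_of_neg hi hj
      · simpa [h] using mul_neg_of_neg_of_pos hj hi
  · rintro ⟨i, j⟩ ⟨k, l⟩ ⟨hi : 0 < f i, hj : f j < 0⟩ ⟨hk : 0 < f k, hl : f l < 0⟩ heq
    simp only [Prod.mk.injEq] at heq ⊢
    rcases le_total i j with h | h <;> rcases le_total k l with h' | h' <;>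
      simp only [h, h', min_eq_left, min_eq_right, max_eq_left, max_eq_right] at heq
    · exact heq
    · rw [heq.1] at hi
      exact absurd hi hl.not_gt
    · rw [heq.1] at hj
      exact absurd hk hj.not_gt
    · exact heq.symm
  · rintro ⟨i, j⟩ ⟨hij, -, hneg⟩
    dsimp only at hij hneg
    rcases mul_neg_iff.1 hneg with ⟨h1, h2⟩ | ⟨h1, h2⟩
    · exact ⟨(i, j), ⟨h1, h2⟩, by simp [hij.le]⟩
    · exact ⟨(j, i), ⟨h2, h1⟩, by simp [hij.le]⟩

open Polynomial in
theorem vertexSliceSequence_of_three_lt {d n : ℕ} (hd : 3 < d) (hn : d < n) {t : Fin n → ℝ}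
    (ht : StrictMono t) : vertexSliceSequence (cyclicPolytope d t) =
      {m : ℕ | ∃ a b i : ℕ, a ≤ n - 1 ∧ b ≤ n - 1 ∧ i ≤ d ∧ a + b + i = n ∧
        m = a * b + i} := by
  ext m
  rw [mem_vertexSliceSequence_iff (by omega) ht.injective (fun _ _ => True) ?_
    fun _ _ _ h => absurd trivial h]
  · simp only [signCount_true, Set.mem_ofPred_eq]
    constructor
    · rintro ⟨hm, p, hp0, hp, rfl⟩
      have hsum := ncard_zero_add_pos_add_neg fun k => p.eval (t k)
      have hz := ncard_eval_eq_zero_le ht.injective p hp0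
      refine ⟨_, _, _, ?_, ?_, hz.trans hp, hsum, rfl⟩
      · -- otherwise all vertices lie strictly on one side
        by_contra! hlt
        rw [show {k | p.eval (t k) < 0}.ncard = 0 by omega,
          show {k | p.eval (t k) = 0}.ncard = 0 by omega] at hm
        omega
      · by_contra! hlt
        rw [show {k | 0 < p.eval (t k)}.ncard = 0 by omega,
          show {k | p.eval (t k) = 0}.ncard = 0 by omega] at hm
        omega
    · rintro ⟨a, b, i, ha, hb, hi, hsum, rfl⟩
      refine ⟨?_, ?_⟩
      · rcases Nat.eq_zero_or_pos i with rfl | h0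
        · have := Nat.mul_pos (show 0 < a by omega) (show 0 < b by omega)
          omega
        · omega
      · obtain ⟨p, hp0, hp, h1, h2, h3⟩ :=
          exists_polynomial_signs ht (a := a) (b := b) (i := i) (by omega) (by omega) hsum
        exact ⟨p, hp0, by omega, by rw [h1, h2, h3]⟩
  · intro i j _ _
    refine ⟨((X - C (t i)) * (X - C (t j))) ^ 2,
      (natDegree_pow_le.trans (Nat.mul_le_mul_left 2 (natDegree_mul_le.trans (by simp)))).trans
        (show 2 * 2 ≤ d by omega), fun k => ?_⟩
    simp only [eval_pow, eval_mul, eval_sub, eval_X, eval_C]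
    exact ⟨sq_nonneg _, by simp [sub_eq_zero, ht.injective.eq_iff]⟩

/-! ### The edges of three-dimensional cyclic polytopes -/

/-- The edges `i < j` of a cyclic polytope in dimension three: those through the first or the last
vertex and those joining consecutive vertices. -/
def IsCyclicEdge {n : ℕ} (i j : Fin n) : Prop :=
  (i : ℕ) = 0 ∨ (j : ℕ) + 1 = n ∨ (j : ℕ) = i + 1

open Polynomial in
theorem exists_support_of_isCyclicEdge {n : ℕ} {t : Fin n → ℝ} (ht : StrictMono t) {i j : Fin n}
    (hij : i < j) (h : IsCyclicEdge i j) : ∃ q : ℝ[X], q.natDegree ≤ 3 ∧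
      ∀ k, 0 ≤ q.eval (t k) ∧ (q.eval (t k) = 0 ↔ k = i ∨ k = j) := by
  rcases h with h | h | h
  · refine ⟨(X - C (t i)) * (X - C (t j)) ^ 2,
      natDegree_mul_le.trans (Nat.add_le_add (natDegree_X_sub_C _).le
        (natDegree_pow_le.trans (by simp) : _ ≤ 2)), fun k => ?_⟩
    have : t i ≤ t k := ht.monotone (Fin.le_def.2 (by omega))
    simp only [eval_pow, eval_mul, eval_sub, eval_X, eval_C]
    exact ⟨mul_nonneg (sub_nonneg.2 this) (sq_nonneg _),
      by simp [sub_eq_zero, ht.injective.eq_iff]⟩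
  · refine ⟨(C (t j) - X) * (X - C (t i)) ^ 2,
      natDegree_mul_le.trans (Nat.add_le_add
        ((natDegree_sub_le _ _).trans (by simp) : _ ≤ 1)
        (natDegree_pow_le.trans (by simp) : _ ≤ 2)), fun k => ?_⟩
    have : t k ≤ t j := ht.monotone (Fin.le_def.2 (by omega))
    simp only [eval_pow, eval_mul, eval_sub, eval_X, eval_C]
    exact ⟨mul_nonneg (sub_nonneg.2 this) (sq_nonneg _),
      by simp [sub_eq_zero, ht.injective.eq_iff, or_comm, eq_comm]⟩
  · refine ⟨(X - C (t i)) * (X - C (t j)),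
      (natDegree_mul_le.trans (by simp)).trans (Nat.le_succ 2), fun k => ?_⟩
    simp only [eval_mul, eval_sub, eval_X, eval_C]
    refine ⟨?_, by simp [sub_eq_zero, ht.injective.eq_iff]⟩
    have hlt := ht hij
    rcases le_or_gt k i with hk | hk
    · have := ht.monotone hk
      exact mul_nonneg_of_nonpos_of_nonpos (by linarith) (by linarith)
    · have : t j ≤ t k := ht.monotone (Fin.le_def.2 (by rw [Fin.lt_def] at hk; omega))
      exact mul_nonneg (by linarith) (by linarith)

/-- The Radon relation of five points of the moment curve in dimension three: the segment through
the second and fourth point meets the triangle of the other three. The coefficients are the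
Vandermonde determinants of the complementary four parameters. -/
theorem exists_radon_relation {a b c d e : ℝ} (hab : a < b) (hbc : b < c) (hcd : c < d)
    (hde : d < e) : ∃ x₁ x₂ x₃ x₄ x₅ : ℝ, 0 < x₁ ∧ 0 < x₂ ∧ 0 < x₃ ∧ 0 < x₄ ∧ 0 < x₅ ∧
      x₁ + x₃ + x₅ = x₂ + x₄ ∧
      x₁ • momentCurve 3 a + x₃ • momentCurve 3 c + x₅ • momentCurve 3 e =
        x₂ • momentCurve 3 b + x₄ • momentCurve 3 d := by
  have vpos : ∀ {x y z w : ℝ}, x < y → y < z → z < w →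
      0 < (y - x) * (z - x) * (w - x) * (z - y) * (w - y) * (w - z) := by
    intro x y z w h1 h2 h3
    have e1 := sub_pos.2 h1
    have e2 := sub_pos.2 h2
    have e3 := sub_pos.2 h3
    have e4 := sub_pos.2 (h1.trans h2)
    have e5 := sub_pos.2 (h2.trans h3)
    have e6 := sub_pos.2 ((h1.trans h2).trans h3)
    positivity
  refine ⟨_, _, _, _, _, vpos hbc hcd hde, vpos (hab.trans hbc) hcd hde,
    vpos hab (hbc.trans hcd) hde, vpos hab hbc (hcd.trans hde), vpos hab hbc hcd, by ring, ?_⟩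
  ext r
  fin_cases r <;> simp [momentCurve] <;> ring

/-- Inner points of a segment that is no edge are combinations of five vertices: mix in a small
multiple of the Radon relation with the first, an intermediate and the last vertex. -/
theorem exists_weights_of_not_isCyclicEdge {n : ℕ} {t : Fin n → ℝ} (ht : StrictMono t)
    {i j : Fin n} (hij : i < j) (h : ¬IsCyclicEdge i j) {α β : ℝ} (hα : 0 < α) (hβ : 0 < β)
    (h1 : α + β = 1) : ∃ w : Fin n → ℝ, (∀ k, 0 ≤ w k) ∧ ∑ k, w k = 1 ∧
      ∑ k, w k • momentCurve 3 (t k) = α • momentCurve 3 (t i) + β • momentCurve 3 (t j) ∧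
      0 < w i ∧ 0 < w j ∧ ∃ k, k ≠ i ∧ k ≠ j ∧ 0 < w k := by
  simp only [IsCyclicEdge, not_or] at h
  obtain ⟨hi, hj, hij'⟩ := h
  rw [Fin.lt_def] at hij
  have hjn := j.2
  obtain ⟨z, hz⟩ : ∃ z : Fin n, (z : ℕ) = 0 := ⟨⟨0, by omega⟩, rfl⟩
  obtain ⟨k, hk⟩ : ∃ k : Fin n, (k : ℕ) = i + 1 := ⟨⟨i + 1, by omega⟩, rfl⟩
  obtain ⟨l, hl⟩ : ∃ l : Fin n, (l : ℕ) = n - 1 := ⟨⟨n - 1, by omega⟩, rfl⟩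
  obtain ⟨x₁, x₂, x₃, x₄, x₅, p1, p2, p3, p4, p5, hsum, hrel⟩ := exists_radon_relation
    (ht (Fin.lt_def.2 (by omega) : z < i)) (ht (Fin.lt_def.2 (by omega) : i < k))
    (ht (Fin.lt_def.2 (by omega) : k < j)) (ht (Fin.lt_def.2 (by omega) : j < l))
  obtain ⟨ε, hε, hε2, hε4⟩ : ∃ ε : ℝ, 0 < ε ∧ 0 < α - ε * x₂ ∧ 0 < β - ε * x₄ := by
    have hm : 0 < min (α / x₂) (β / x₄) := lt_min (div_pos hα p2) (div_pos hβ p4)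
    obtain ⟨ε, hε, hlt⟩ := exists_between hm
    refine ⟨ε, hε, sub_pos.2 ?_, sub_pos.2 ?_⟩
    · exact (lt_div_iff₀ p2).1 (hlt.trans_le (min_le_left _ _))
    · exact (lt_div_iff₀ p4).1 (hlt.trans_le (min_le_right _ _))
  set w : Fin n → ℝ := Pi.single i (α - ε * x₂) + Pi.single j (β - ε * x₄) +
    Pi.single z (ε * x₁) + Pi.single k (ε * x₃) + Pi.single l (ε * x₅) with hw
  have hle : ∀ (a b : Fin n) (x : ℝ), 0 < x → 0 ≤ (Pi.single a x : Fin n → ℝ) b :=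
    fun a b x hx => (Pi.single_nonneg.2 hx.le : (0 : Fin n → ℝ) ≤ Pi.single a x) b
  have n1 := fun b => hle i b _ hε2
  have n2 := fun b => hle j b _ hε4
  have n3 := fun b => hle z b _ (mul_pos hε p1)
  have n4 := fun b => hle k b _ (mul_pos hε p3)
  have n5 := fun b => hle l b _ (mul_pos hε p5)
  have hwb : ∀ b, w b = (Pi.single i (α - ε * x₂) : Fin n → ℝ) b +
    (Pi.single j (β - ε * x₄) : Fin n → ℝ) b + (Pi.single z (ε * x₁) : Fin n → ℝ) b +
    (Pi.single k (ε * x₃) : Fin n → ℝ) b + (Pi.single l (ε * x₅) : Fin n → ℝ) b := fun b => rfl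
  refine ⟨w, fun b => ?_, ?_, ?_, ?_, ?_, k, ?_, ?_, ?_⟩
  · linarith [hwb b, n1 b, n2 b, n3 b, n4 b, n5 b]
  · simp only [hwb, Finset.sum_add_distrib, Finset.sum_pi_single', Finset.mem_univ, if_true]
    linear_combination h1 + ε * hsum
  · simp only [hwb, add_smul, Finset.sum_add_distrib, Pi.single_apply, ite_smul, zero_smul,
      Finset.sum_ite_eq', Finset.mem_univ, if_true]
    linear_combination (norm := module) ε • hrel
  · have := Pi.single_eq_same (M := fun _ => ℝ) i (α - ε * x₂)
    linarith [hwb i, n2 i, n3 i, n4 i, n5 i]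
  · have := Pi.single_eq_same (M := fun _ => ℝ) j (β - ε * x₄)
    linarith [hwb j, n1 j, n3 j, n4 j, n5 j]
  · exact fun h => by rw [h] at hk; omega
  · exact fun h => by rw [h] at hk; omega
  · have := Pi.single_eq_same (M := fun _ => ℝ) k (ε * x₃)
    linarith [hwb k, n1 k, n2 k, n3 k, n5 k, mul_pos hε p3]

/-! ### Counting crossed edges in dimension three -/

/-- The vertex count of a slice in dimension three, in terms of the signs `σ` at the vertices
`0, …, p + 2`. -/
theorem signCount_isCyclicEdge {p : ℕ} (g : ℕ → ℝ) (σ : ℕ → SignType)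
    (hσ : ∀ k < p + 3, SignType.sign (g k) = σ k) :
    signCount (n := p + 3) IsCyclicEdge (fun k => g k) =
      (if σ 0 = 0 then 1 else 0) + (if σ (p + 2) = 0 then 1 else 0) +
      (if σ 0 * σ (p + 2) = -1 then 1 else 0) +
      ∑ k ∈ Finset.range (p + 1), ((if σ (k + 1) = 0 then 1 else 0) +
        (if σ 0 * σ (k + 1) = -1 then 1 else 0) +
        (if σ (k + 1) * σ (p + 2) = -1 then 1 else 0)) +
      ∑ k ∈ Finset.range p, (if σ (k + 1) * σ (k + 2) = -1 then 1 else 0) := by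
  classical
  have hz : {k : Fin (p + 3) | g k = 0}.ncard =
      ∑ k ∈ Finset.range (p + 3), if σ k = 0 then 1 else 0 := by
    rw [Set.ncard_eq_toFinset_card', Set.toFinset_ofPred, Finset.card_filter,
      ← Fin.sum_univ_eq_sum_range (fun k => if σ k = 0 then 1 else 0)]
    refine Finset.sum_congr rfl fun k _ => ?_
    simp only [← hσ k k.2, sign_eq_zero_iff]
  set F : ℕ → ℕ → ℕ := fun i j => if i < j ∧ (i = 0 ∨ j + 1 = p + 3 ∨ j = i + 1) ∧
    σ i * σ j = -1 then 1 else 0 with hF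
  have hx : {q : Fin (p + 3) × Fin (p + 3) | q.1 < q.2 ∧ IsCyclicEdge q.1 q.2 ∧
      g q.1 * g q.2 < 0}.ncard =
        ∑ i ∈ Finset.range (p + 3), ∑ j ∈ Finset.range (p + 3), F i j := by
    rw [Set.ncard_eq_toFinset_card', Set.toFinset_ofPred, Finset.card_filter,
      Fintype.sum_prod_type,
      ← Fin.sum_univ_eq_sum_range (fun i => ∑ j ∈ Finset.range (p + 3), F i j)]
    refine Finset.sum_congr rfl fun i _ => ?_
    rw [← Fin.sum_univ_eq_sum_range (fun j => F i j)]
    refine Finset.sum_congr rfl fun j _ => ?_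
    simp only [hF, ← hσ i i.2, ← hσ j j.2, ← sign_mul, sign_eq_neg_one_iff, IsCyclicEdge,
      Fin.lt_def]
  have hlast : ∀ j ∈ Finset.range (p + 3), F (p + 2) j = 0 := fun j hj => by
    rw [Finset.mem_range] at hj
    exact if_neg fun h => by omega
  have hrow0 : ∀ j, F 0 (j + 1) = if σ 0 * σ (j + 1) = -1 then 1 else 0 := fun j => by
    simp [hF]
  have hcol0 : ∀ i, F i 0 = 0 := fun i => by simp [hF]
  have hcolL : ∀ i ∈ Finset.range (p + 1), F (i + 1) (p + 2) =
      if σ (i + 1) * σ (p + 2) = -1 then 1 else 0 := fun i hi => by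
    rw [Finset.mem_range] at hi
    simp [hF, hi]
  have hin : ∀ i, ∀ j ∈ Finset.range (p + 1), F (i + 1) (j + 1) =
      if j = i + 1 then (if σ (i + 1) * σ (j + 1) = -1 then 1 else 0) else 0 := by
    intro i j hj
    rw [Finset.mem_range] at hj
    by_cases h : j = i + 1
    · subst h
      simp [hF]
    · rw [if_neg h]
      exact if_neg fun h' => by omega
  have hrow : ∀ i ∈ Finset.range (p + 1), ∑ j ∈ Finset.range (p + 3), F (i + 1) j =
      (if i < p then (if σ (i + 1) * σ (i + 2) = -1 then 1 else 0) else 0) +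
        if σ (i + 1) * σ (p + 2) = -1 then 1 else 0 := by
    intro i hi
    rw [Finset.sum_range_succ, Finset.sum_range_succ', hcol0, hcolL i hi,
      Finset.sum_congr rfl (hin i), Finset.sum_ite_eq', add_zero]
    simp only [Finset.mem_range, Nat.add_lt_add_iff_right]
  rw [signCount, hz, hx, Finset.sum_range_succ, Finset.sum_range_succ',
    Finset.sum_range_succ _ (p + 2), Finset.sum_eq_zero hlast, Finset.sum_range_succ' _ (p + 1),
    Finset.sum_congr rfl hrow, Finset.sum_range_succ (F 0) (p + 2), Finset.sum_range_succ' (F 0),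
    hcol0]
  simp only [hrow0, Finset.sum_add_distrib]
  rw [Finset.sum_range_succ (fun i => if i < p then _ else _), if_neg (lt_irrefl p),
    Finset.sum_congr rfl fun i hi => if_pos (Finset.mem_range.1 hi)]
  ring

/-- At most `2 (n - 2)` vertices, where `n = p + 3`: if the end vertices lie on the same side, each
inner vertex on the other side lies on two crossed edges to the ends, and each inner vertex on the
common side on at most two crossed edges between neighbours; otherwise an inner vertex lies on at
most one crossed edge to the ends and each pair of inner neighbours counts at most once. -/
theorem signCount_isCyclicEdge_le {p : ℕ} (hp : 1 ≤ p) (g : ℕ → ℝ) :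
    signCount (n := p + 3) IsCyclicEdge (fun k => g k) ≤ 2 * (p + 1) := by
  set σ : ℕ → SignType := fun k => SignType.sign (g k) with hσ
  rw [signCount_isCyclicEdge g σ fun _ _ => rfl]
  by_cases hA : σ 0 * σ (p + 2) = 1
  · have e1 : ∀ a b : SignType, a * b = 1 →
        (if a = 0 then 1 else 0) + (if b = 0 then 1 else 0) + (if a * b = -1 then 1 else 0) = 0 := by
      decide
    have e2 : ∀ a b : SignType, a * b = 1 → ∀ s : SignType,
        (if s = 0 then 1 else 0) + (if a * s = -1 then 1 else 0) + (if s * b = -1 then 1 else 0) +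
          2 * (if s * a = 1 then 1 else 0) ≤ 2 := by
      decide
    have e3 : ∀ a s r : SignType, a ≠ 0 → (if s * r = -1 then 1 else 0) ≤
        (if s * a = 1 then 1 else 0) + (if r * a = 1 then 1 else 0) := by
      decide
    have ha : σ 0 ≠ 0 := fun h => by simp [h] at hA
    have s2 := Finset.sum_le_sum fun k (_ : k ∈ Finset.range (p + 1)) => e2 _ _ hA (σ (k + 1))
    have s3 := Finset.sum_le_sum fun k (_ : k ∈ Finset.range p) => e3 _ (σ (k + 1)) (σ (k + 2)) ha
    have u1 := Finset.sum_range_succ (fun k => if σ (k + 1) * σ 0 = 1 then 1 else 0) p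
    have u2 : ∑ k ∈ Finset.range (p + 1), (if σ (k + 1) * σ 0 = 1 then 1 else 0) =
        ∑ k ∈ Finset.range p, (if σ (k + 2) * σ 0 = 1 then 1 else 0) +
          if σ 1 * σ 0 = 1 then 1 else 0 := Finset.sum_range_succ' _ p
    rw [Finset.sum_add_distrib, ← Finset.mul_sum, Finset.sum_const, Finset.card_range,
      smul_eq_mul] at s2
    rw [Finset.sum_add_distrib] at s3
    rw [e1 _ _ hA]
    omega
  · have e2 : ∀ a b : SignType, a * b ≠ 1 → ¬(a = 0 ∧ b = 0) → ∀ s : SignType,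
        (if s = 0 then 1 else 0) + (if a * s = -1 then 1 else 0) +
          (if s * b = -1 then 1 else 0) ≤ 1 := by
      decide
    by_cases hB : σ 0 = 0 ∧ σ (p + 2) = 0
    · have e3 : ∀ s r : SignType, (if s = 0 then 1 else 0) + (if s * r = -1 then 1 else 0) ≤ 1 := by
        decide
      have s3 := Finset.sum_le_sum fun k (_ : k ∈ Finset.range p) => e3 (σ (k + 1)) (σ (k + 2))
      rw [Finset.sum_add_distrib, Finset.sum_const, Finset.card_range, smul_eq_mul] at s3
      simp only [hB.1, hB.2, zero_mul, mul_zero, if_true, show (0 : SignType) ≠ -1 by decide,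
        if_false, add_zero, Finset.sum_range_succ _ p]
      split_ifs <;> omega
    · have e1 : ∀ a b : SignType, ¬(a = 0 ∧ b = 0) →
          (if a = 0 then 1 else 0) + (if b = 0 then 1 else 0) +
            (if a * b = -1 then 1 else 0) ≤ 1 := by
        decide
      have e3 : ∀ s r : SignType, (if s * r = -1 then 1 else 0) ≤ 1 := by decide
      have s1 := e1 _ _ hB
      have s2 := Finset.sum_le_sum fun k (_ : k ∈ Finset.range (p + 1)) =>
        e2 _ _ hA hB (σ (k + 1))
      have s3 := Finset.sum_le_sum fun k (_ : k ∈ Finset.range p) => e3 (σ (k + 1)) (σ (k + 2))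
      simp only [Finset.sum_const, Finset.card_range, smul_eq_mul] at s2 s3
      omega

/-- The vertex count when the `K` consecutive vertices from `l + 1` on lie on one side and all other
vertices, the end vertices among them, on the other. -/
theorem signCount_block {p l K : ℕ} (hl : l ≤ 1) (hK : 1 ≤ K) (hlK : l + K ≤ p + 1) (g : ℕ → ℝ)
    (hneg : ∀ k < p + 3, l + 1 ≤ k → k < l + 1 + K → g k < 0)
    (hpos : ∀ k < p + 3, ¬(l + 1 ≤ k ∧ k < l + 1 + K) → 0 < g k) :
    signCount (n := p + 3) IsCyclicEdge (fun k => g k) =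
      2 * K + l + if l + K ≤ p then 1 else 0 := by
  set σ : ℕ → SignType := fun k => if l + 1 ≤ k ∧ k < l + 1 + K then -1 else 1 with hσ
  rw [signCount_isCyclicEdge g σ]
  · have h0 : σ 0 = 1 := if_neg (by omega)
    have hL : σ (p + 2) = 1 := if_neg (by omega)
    have h2 : ∀ k, ((if σ (k + 1) = 0 then 1 else 0) + (if σ 0 * σ (k + 1) = -1 then 1 else 0) +
        (if σ (k + 1) * σ (p + 2) = -1 then 1 else 0)) =
          if k ∈ Finset.Ico l (l + K) then 2 else 0 := by
      intro k
      simp only [h0, hL, one_mul, mul_one, Finset.mem_Ico]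
      by_cases h : l ≤ k ∧ k < l + K
      · have : σ (k + 1) = -1 := if_pos (by omega)
        rw [this, if_pos h]
        decide
      · have : σ (k + 1) = 1 := if_neg (by omega)
        rw [this, if_neg h]
        decide
    have h3 : ∀ k, (if σ (k + 1) * σ (k + 2) = -1 then 1 else 0) =
        (if k + 1 = l then 1 else 0) + if k = l + K - 1 then 1 else 0 := by
      intro k
      by_cases h : k + 1 = l
      · have e1 : σ (k + 1) = 1 := if_neg (by omega)
        have e2 : σ (k + 2) = -1 := if_pos (by omega)
        rw [e1, e2, if_pos h, if_neg (by omega : ¬k = l + K - 1)]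
        decide
      by_cases h' : k = l + K - 1
      · have e1 : σ (k + 1) = -1 := if_pos (by omega)
        have e2 : σ (k + 2) = 1 := if_neg (by omega)
        rw [e1, e2, if_neg h, if_pos h']
        decide
      have : σ (k + 2) = σ (k + 1) := by
        simp only [hσ]
        congr 1
        rw [eq_iff_iff]
        omega
      rw [this, if_neg h, if_neg h', if_neg]
      generalize σ (k + 1) = s
      revert s
      decide
    have hsub : Finset.Ico l (l + K) ⊆ Finset.range (p + 1) := fun k hk => by
      rw [Finset.mem_Ico] at hk
      rw [Finset.mem_range]
      omega
    have h4 : ∑ k ∈ Finset.range p, (if k + 1 = l then 1 else 0) = l := by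
      rcases Nat.le_one_iff_eq_zero_or_eq_one.1 hl with rfl | rfl
      · simp
      · simp only [Nat.add_eq_right, Finset.sum_ite_eq', Finset.mem_range]
        exact if_pos (by omega)
    rw [Finset.sum_congr rfl fun k _ => h2 k, Finset.sum_congr rfl fun k _ => h3 k,
      Finset.sum_ite_mem, Finset.inter_eq_right.2 hsub, Finset.sum_const, Nat.card_Ico,
      Finset.sum_add_distrib, h4, Finset.sum_ite_eq', h0, hL, Nat.add_sub_cancel_left, smul_eq_mul]
    have : (l + K - 1 ∈ Finset.range p) ↔ l + K ≤ p := by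
      rw [Finset.mem_range]
      omega
    simp only [this, show ¬(1 : SignType) = 0 by decide, show ¬(1 * 1 : SignType) = -1 by decide,
      if_false]
    ring
  · intro k hk
    by_cases h : l + 1 ≤ k ∧ k < l + 1 + K
    · rw [sign_neg (hneg k hk h.1 h.2)]
      exact (if_pos h).symm
    · rw [sign_pos (hpos k hk h)]
      exact (if_neg h).symm

theorem signCount_of_nonneg {n : ℕ} (Edge : Fin n → Fin n → Prop) {f : Fin n → ℝ}
    (h : ∀ k, 0 ≤ f k) : signCount Edge f = {k | f k = 0}.ncard := by
  have : {p : Fin n × Fin n | p.1 < p.2 ∧ Edge p.1 p.2 ∧ f p.1 * f p.2 < 0} = ∅ := by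
    ext p
    simp only [Set.mem_ofPred_eq, Set.mem_empty_iff_false, iff_false]
    exact fun hp => hp.2.2.not_ge (mul_nonneg (h _) (h _))
  rw [signCount, this, Set.ncard_empty, add_zero]

open Polynomial in
/-- Every number from `1` to `2 (n - 2)` is attained by a polynomial of degree at most two: the
first two by supporting planes, the others by cutting off a block of inner vertices. -/
theorem exists_polynomial_signCount {p m : ℕ} (hp : 1 ≤ p) {t : Fin (p + 3) → ℝ}
    (ht : StrictMono t) (h1 : 1 ≤ m) (hm : m ≤ 2 * (p + 1)) :
    ∃ q : ℝ[X], 0 < q.natDegree ∧ q.natDegree ≤ 2 ∧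
      signCount IsCyclicEdge (fun k => q.eval (t k)) = m := by
  rcases (by omega : m = 1 ∨ m = 2 ∨ 3 ≤ m) with rfl | rfl | h3
  · refine ⟨X - C (t 0), by simp, by simp, ?_⟩
    rw [signCount_of_nonneg]
    · simp [sub_eq_zero, ht.injective.eq_iff]
    · intro k
      simpa using ht.monotone (Fin.zero_le k)
  · refine ⟨(X - C (t 0)) * (X - C (t 1)), ?_, ?_, ?_⟩
    · rw [natDegree_mul (X_sub_C_ne_zero _) (X_sub_C_ne_zero _)]
      simp
    · exact natDegree_mul_le.trans (by simp)
    rw [signCount_of_nonneg]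
    · have : {k | ((X - C (t 0)) * (X - C (t 1))).eval (t k) = 0} = {0, 1} := by
        ext k
        simp [sub_eq_zero, ht.injective.eq_iff]
      rw [this, Set.ncard_pair (by simp)]
    · intro k
      simp only [eval_mul, eval_sub, eval_X, eval_C]
      rcases eq_or_ne k 0 with rfl | hk
      · simp
      · have hk1 : 1 ≤ (k : ℕ) := Nat.one_le_iff_ne_zero.2 fun h => hk (Fin.ext h)
        exact mul_nonneg (sub_nonneg.2 (ht.monotone (Fin.zero_le k)))
          (sub_nonneg.2 (ht.monotone (Fin.le_def.2 (by simpa using hk1))))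
  · obtain ⟨l, K, hl, hK, hlK, hval⟩ : ∃ l K : ℕ, l ≤ 1 ∧ 1 ≤ K ∧ l + K ≤ p + 1 ∧
        2 * K + l + (if l + K ≤ p then 1 else 0) = m := by
      rcases Nat.even_or_odd m with ⟨r, hr⟩ | ⟨r, hr⟩
      · rcases (by omega : r = p + 1 ∨ r ≤ p) with h | h
        · exact ⟨0, p + 1, by omega, by omega, by omega, by rw [if_neg (by omega)]; omega⟩
        · exact ⟨1, r - 1, by omega, by omega, by omega, by rw [if_pos (by omega)]; omega⟩
      · exact ⟨0, r, by omega, by omega, by omega, by rw [if_pos (by omega)]; omega⟩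
    obtain ⟨x, hx⟩ := exists_separator ht (b := l + 1) (by omega) (by omega)
    obtain ⟨y, hy⟩ := exists_separator ht (b := l + 1 + K) (by omega) (by omega)
    refine ⟨(X - C x) * (X - C y), ?_, natDegree_mul_le.trans (by simp), ?_⟩
    · rw [natDegree_mul (X_sub_C_ne_zero _) (X_sub_C_ne_zero _)]
      simp
    set g : ℕ → ℝ := fun k => if h : k < p + 3 then (t ⟨k, h⟩ - x) * (t ⟨k, h⟩ - y) else 0 with hg
    have hfg : (fun k => ((X - C x) * (X - C y)).eval (t k)) = fun k : Fin (p + 3) => g k := by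
      ext k
      simp [hg]
    rw [hfg, signCount_block hl hK hlK g, hval]
    · intro k hk h h'
      simp only [hg, hk, dif_pos]
      exact mul_neg_of_pos_of_neg (sub_pos.2 ((hx ⟨k, hk⟩).2 h)) (sub_neg.2 ((hy ⟨k, hk⟩).1 h'))
    · intro k hk h
      simp only [hg, hk, dif_pos]
      rcases (by omega : k < l + 1 ∨ l + 1 + K ≤ k) with h' | h'
      · exact mul_pos_of_neg_of_neg (sub_neg.2 ((hx ⟨k, hk⟩).1 h'))
          (sub_neg.2 ((hy ⟨k, hk⟩).1 (by dsimp only; omega)))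
      · exact mul_pos (sub_pos.2 ((hx ⟨k, hk⟩).2 (by dsimp only; omega)))
          (sub_pos.2 ((hy ⟨k, hk⟩).2 h'))

theorem vertexSliceSequence_three {n : ℕ} (hn : 3 < n) {t : Fin n → ℝ} (ht : StrictMono t) :
    vertexSliceSequence (cyclicPolytope 3 t) = Set.Icc 1 (2 * (n - 2)) := by
  obtain ⟨p, rfl⟩ : ∃ p, n = p + 3 := ⟨n - 3, by omega⟩
  ext m
  rw [mem_vertexSliceSequence_iff (by omega) ht.injective IsCyclicEdge
    (fun i j hij h => exists_support_of_isCyclicEdge ht hij h)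
    fun i j hij h α β hα hβ h1 => exists_weights_of_not_isCyclicEdge ht hij h hα hβ h1, Set.mem_Icc]
  constructor
  · rintro ⟨hm, q, -, -, rfl⟩
    refine ⟨hm, ?_⟩
    have := signCount_isCyclicEdge_le (p := p) (by omega)
      fun k => if h : k < p + 3 then q.eval (t ⟨k, h⟩) else 0
    simpa using this
  · rintro ⟨h1, hm⟩
    obtain ⟨q, hq0, hq, hcount⟩ := exists_polynomial_signCount (p := p) (by omega) ht h1
      (by omega)
    exact ⟨h1, q, hq0, hq.trans (by omega), hcount.symm⟩

theorem mainTheorem2 (d n : ℕ) (hd : 3 ≤ d) (hn : d < n) (t : Fin n → ℝ) (ht : StrictMono t) :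
    (d = 3 → vertexSliceSequence (cyclicPolytope d t) = Set.Icc 1 (2 * (n - 2))) ∧
    (3 < d → vertexSliceSequence (cyclicPolytope d t) =
      {m : ℕ | ∃ a b i : ℕ, a ≤ n - 1 ∧ b ≤ n - 1 ∧ i ≤ d ∧ a + b + i = n ∧ m = a * b + i}) := by
  refine ⟨?_, fun h => vertexSliceSequence_of_three_lt h hn ht⟩
  rintro rfl
  exact vertexSliceSequence_three hn ht
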